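/- For $k\in\mathbb N$ let $n=2^k$ and let $H:\mathbb F_2^k\to\mathbb F_2^n$ be the Hadamard code, $H(x)=(\langle x,z\rangle)_{z\in\mathbb F_2^k}$ with $\langle x,z\rangle=\sum_i x_iz_i$; let $d$ denote the Hamming distance. Consider circuits that act on qubits initialized to $|0\rangle$ and on classical bits (the input bits, and work bits initialized to $0$) by four kinds of operations: arbitrary single-qubit unitary gates and CNOT gates, each possibly controlled by a classical bit; computational-basis measurements of a qubit whose outcome is written to a classical bit; and classical parity gates of unbounded fan-in. A layer consists of operations that act on pairwise disjoint qubits and none of which writes a classical bit that another one of them reads or writes; the depth is the number of layers (of gates, measurements and parity gates alike). A family of $\mathsf{QNC}^0[\oplus]$-circuits is a family of such circuits of constant depth and of size polynomial in the number of input bits. There are a family of $\mathsf{QNC}^0[\oplus]$-circuits $(\mathcal C_n)_{n=2^k,\,k\in\mathbb N}$, where $\mathcal C_n$ has $n$ input bits, $k$ output bits and depth at most $65$, and an absolute constant $c>0$ such that the following holds. For every $k\in\mathbb N$, $n=2^k$, every $\varepsilon\in(0,1/2]$, every $y\in\mathbb F_2^n$ and every $x\in\mathbb F_2^k$ with $d(y,H(x))\le(\tfrac12-\varepsilon)n$,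 on input $y$ the circuit $\mathcal C_n$ outputs $x$ with probability at least $c\,\varepsilon^2$. -/

import Mathlib

/-- An elementary operation on qubits `Q` and classical bits `B`. Quantum gates are all single-qubit
unitaries and CNOT; each may be controlled by a classical bit (`ctrl = some b`: the gate is applied
iff bit `b` equals `1`; `ctrl = none`: it is always applied). `measure i a` measures qubit `i` in the
computational basis and stores the outcome in bit `a`. `parity S a` is the classical parity gate of
unbounded fan-in, storing the sum modulo 2 of the bits in `S` in bit `a`. -/
inductive Op (Q B : Type) : Type
  | gate (U : Matrix.unitaryGroup (ZMod 2) ℂ) (i : Q) (ctrl : Option B)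
  | cnot (i j : Q) (hij : i ≠ j) (ctrl : Option B)
  | measure (i : Q) (a : B)
  | parity (S : Finset B) (a : B)

namespace Op

variable {Q B : Type}

/-- The qubits an operation acts on. -/
def qubits [DecidableEq Q] : Op Q B → Finset Q
  | gate _ i _ => {i}
  | cnot i j _ _ => {i, j}
  | measure i _ => {i}
  | parity _ _ => ∅

/-- The classical bits an operation reads. -/
def reads : Op Q B → Finset B
  | gate _ _ ctrl => ctrl.toFinset
  | cnot _ _ _ ctrl => ctrl.toFinset
  | measure _ _ => ∅
  | parity S _ => S

/-- The classical bits an operation writes. -/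
def writes : Op Q B → Finset B
  | gate _ _ _ => ∅
  | cnot _ _ _ _ => ∅
  | measure _ a => {a}
  | parity _ a => {a}

/-- Two operations are independent, so that they can be carried out in the same layer, if they act
on disjoint sets of qubits and neither writes a classical bit that the other reads or writes.
(Several operations may read the same classical bit.) -/
def Independent [DecidableEq Q] (o p : Op Q B) : Prop :=
  Disjoint o.qubits p.qubits ∧ Disjoint o.writes p.writes ∧
    Disjoint o.writes p.reads ∧ Disjoint o.reads p.writes

end Op

/-- One measurement branch of a computation: the contents of the classical bits and the
unnormalized state vector of the qubits, by its amplitudes in the computational basis. The squared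
norm of the vector is the probability of the branch. -/
structure Branch (Q B : Type) : Type where
  bits : B → ZMod 2
  amp : (Q → ZMod 2) → ℂ

/-- The probability of a branch. -/
noncomputable def Branch.weight {Q B : Type} [Fintype Q] [DecidableEq Q] (s : Branch Q B) : ℝ :=
  ∑ z, ‖s.amp z‖ ^ 2

namespace Op

variable {Q B : Type} [DecidableEq Q] [DecidableEq B]

/-- Whether a gate with the given classical control is applied. -/
def fires (ctrl : Option B) (c : B → ZMod 2) : Bool :=
  match ctrl with
  | none => true
  | some b => decide (c b = 1)

/-- The single-qubit gate `U` on qubit `i`, tensored with the identity on the other qubits. -/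
noncomputable def applyGate (U : Matrix (ZMod 2) (ZMod 2) ℂ) (i : Q)
    (ψ : (Q → ZMod 2) → ℂ) : (Q → ZMod 2) → ℂ :=
  fun z => ∑ r : ZMod 2, U (z i) r * ψ (Function.update z i r)

/-- The CNOT gate with control `i` and target `j`. -/
def applyCnot (i j : Q) (ψ : (Q → ZMod 2) → ℂ) : (Q → ZMod 2) → ℂ :=
  fun z => ψ (Function.update z j (z j + z i))

/-- The projection onto the basis states in which qubit `i` has value `r`. -/
def project (i : Q) (r : ZMod 2) (ψ : (Q → ZMod 2) → ℂ) : (Q → ZMod 2) → ℂ :=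
  fun z => if z i = r then ψ z else 0

/-- The branches into which an operation turns a branch: one, except for a measurement, which gives
one for each outcome. -/
noncomputable def step : Op Q B → Branch Q B → List (Branch Q B)
  | gate U i ctrl, s =>
      [⟨s.bits, if fires ctrl s.bits then applyGate U.1 i s.amp else s.amp⟩]
  | cnot i j _ ctrl, s =>
      [⟨s.bits, if fires ctrl s.bits then applyCnot i j s.amp else s.amp⟩]
  | measure i a, s =>
      [⟨Function.update s.bits a 0, project i 0 s.amp⟩,
        ⟨Function.update s.bits a 1, project i 1 s.amp⟩]
  | parity S a, s =>
      [⟨Function.update s.bits a (∑ b ∈ S, s.bits b), s.amp⟩]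

/-- The probability that, when the operations are carried out in order from the branch `s`, the
final contents of the classical bits lie in `E`. -/
noncomputable def prob [Fintype Q] (E : Set (B → ZMod 2)) : List (Op Q B) → Branch Q B → ℝ
  | [], s => E.indicator (fun _ => s.weight) s.bits
  | o :: os, s => ((o.step s).map (prob E os)).sum

end Op

/-- A circuit with classical input bits indexed by `ι` and classical output bits indexed by `κ`,
built from single-qubit gates, CNOT gates, intermediate measurements and classical parity gates.
It has finitely many qubits, all starting in state `|0⟩`, and finitely many classical bits: the
input bits and further work bits, which start at `0`. Its operations are grouped in layers of
pairwise independent operations. -/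
structure ParityCircuit (ι κ : Type) : Type 1 where
  qubit : Type
  work : Type
  [fintypeQubit : Fintype qubit]
  [decidableEqQubit : DecidableEq qubit]
  [fintypeWork : Fintype work]
  [decidableEqWork : DecidableEq work]
  layers : List (List (Op qubit (ι ⊕ work)))
  independent : ∀ L ∈ layers, L.Pairwise Op.Independent
  output : κ → ι ⊕ work

namespace ParityCircuit

attribute [instance] fintypeQubit decidableEqQubit fintypeWork decidableEqWork

variable {ι κ : Type}

/-- The number of layers; layers of gates, of measurements and of parity gates all count. -/
def depth (C : ParityCircuit ι κ) : ℕ := C.layers.length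

/-- The number of operations, qubits and work bits. -/
def size (C : ParityCircuit ι κ) : ℕ :=
  C.layers.flatten.length + Fintype.card C.qubit + Fintype.card C.work

/-- The initial branch on input `y`: the classical bits hold `y` and zeros, the qubits are in the
basis state `|0⋯0⟩`. -/
def init (C : ParityCircuit ι κ) (y : ι → ZMod 2) : Branch C.qubit (ι ⊕ C.work) where
  bits := Sum.elim y 0
  amp := Pi.single 0 1

/-- The probability that the circuit outputs `x` on input `y`. -/
noncomputable def outputProb [DecidableEq ι] (C : ParityCircuit ι κ) (y : ι → ZMod 2)
    (x : κ → ZMod 2) : ℝ :=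
  Op.prob {c | ∀ j, c (C.output j) = x j} C.layers.flatten (C.init y)

end ParityCircuit

/-- A family of `QNC⁰[⊕]`-circuits: constant depth, and size polynomial in the number of input
bits. -/
def IsQNC0Parity {ι κ : ℕ → Type} [∀ k, Fintype (ι k)] (C : ∀ k, ParityCircuit (ι k) (κ k)) :
    Prop :=
  (∃ d : ℕ, ∀ k, (C k).depth ≤ d) ∧
    ∃ p : Polynomial ℕ, ∀ k, (C k).size ≤ p.eval (Fintype.card (ι k))

/-- The Hadamard code: the codeword of `x ∈ 𝔽₂ᵏ` lists the inner products `⟨x, z⟩` over all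
`z ∈ 𝔽₂ᵏ`, so its `n = 2ᵏ` coordinates are indexed by `𝔽₂ᵏ`. -/
def hadamardCode {k : ℕ} (x : Fin k → ZMod 2) : (Fin k → ZMod 2) → ZMod 2 :=
  fun z => ∑ i, x i * z i

/-!
The idea is to run the Bernstein–Vazirani algorithm with the phase oracle `|z⟩ ↦ (-1)^{y z} |z⟩` of
the received word `y`: reading off `∑ z, (-1)^{y z} |z⟩` in the Fourier basis gives `x` with
probability exactly `(1 - 2 d / n) ^ 2`, where `d` is the distance from `y` to the codeword of `x`.

Constant depth comes from expanding the oracle in characters. Orthogonality gives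
`π [y z = 1] = ∑ S w, (π / n) [y w = 1] (-1)^{⟨S, w⟩} (-1)^{⟨S, z⟩}`, so `(-1)^{y z}` is a product
of rotations, one for each pair `(S, w)`, controlled by the input bit `y w` and acting on a qubit
which holds `⟨S, z⟩`; they act in one layer once each pair has its own qubit. Such registers, with
copies of `z` and the partial sums of the inner products added, are the solutions of sparse linear
equations. Their superposition over `z` arises by measuring these equations on a uniform
superposition of all strings: a shift that restores the all-zero outcome is linear in the outcome
found, hence computed by one layer of parity gates.
-/

open Finset Matrix

theorem sum_zmod_two {M : Type*} [AddCommMonoid M] (f : ZMod 2 → M) : ∑ r, f r = f 0 + f 1 :=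
  Fin.sum_univ_two f

theorem zmod_two_eq_zero_or_one : ∀ a : ZMod 2, a = 0 ∨ a = 1 := by
  decide

section Extend

variable {α β γ : Type*}

theorem extend_comp_equiv {δ : Type*} (e : δ ≃ α) {g : α → β} (hg : g.Injective) (m : α → γ)
    (b : β → γ) : Function.extend (g ∘ e) (m ∘ e) b = Function.extend g m b := by
  rw [Function.Injective.extend_comp e.injective hg]
  congr 1
  funext a
  obtain ⟨d, rfl⟩ := e.surjective a
  exact e.injective.extend_apply _ _ d

theorem update_extend_fin_succ [DecidableEq β] {n : ℕ} {g : Fin (n + 1) → β} (hg : g.Injective)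
    (m : Fin (n + 1) → γ) (b : β → γ) :
    Function.update (Function.extend (g ∘ Fin.succ) (m ∘ Fin.succ) b) (g 0) (m 0) =
      Function.extend g m b := by
  funext c
  rcases eq_or_ne c (g 0) with rfl | hc
  · rw [Function.update_self, hg.extend_apply]
  rw [Function.update_of_ne hc]
  by_cases h : ∃ i, g i = c
  · obtain ⟨i, rfl⟩ := h
    obtain ⟨i, rfl⟩ := Fin.exists_succ_eq.2 (ne_of_apply_ne g hc)
    rw [hg.extend_apply]
    exact (hg.comp (Fin.succ_injective n)).extend_apply _ _ i
  · rw [Function.extend_apply' _ _ _ h, Function.extend_apply' _ _ _ fun ⟨i, hi⟩ => h ⟨_, hi⟩]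

theorem notMem_range_comp_fin_succ {n : ℕ} {g : Fin (n + 1) → β} (hg : g.Injective) :
    g 0 ∉ Set.range (g ∘ Fin.succ) :=
  fun ⟨i, hi⟩ => i.succ_ne_zero (hg hi)

theorem extend_fin_succ_update [DecidableEq β] {n : ℕ} {g : Fin (n + 1) → β} (hg : g.Injective)
    (m : Fin (n + 1) → γ) (b : β → γ) :
    Function.extend (g ∘ Fin.succ) (m ∘ Fin.succ) (Function.update b (g 0) (m 0)) =
      Function.extend g m b := by
  rw [← update_extend_fin_succ hg]
  funext c
  rcases eq_or_ne c (g 0) with rfl | hc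
  · rw [Function.extend_apply' _ _ _ (notMem_range_comp_fin_succ hg), Function.update_self,
      Function.update_self]
  · simp only [Function.extend_def, Function.update_of_ne hc]

theorem extend_fin_succ_mul_mulSingle [DecidableEq β] [MulOneClass γ] {n : ℕ} {g : Fin (n + 1) → β}
    (hg : g.Injective) (m : Fin (n + 1) → γ) :
    Function.extend (g ∘ Fin.succ) (m ∘ Fin.succ) 1 * Pi.mulSingle (g 0) (m 0) =
      Function.extend g m 1 := by
  rw [← update_extend_fin_succ hg]
  funext c
  rcases eq_or_ne c (g 0) with rfl | hc
  · rw [Pi.mul_apply, Function.extend_apply' _ _ _ (notMem_range_comp_fin_succ hg), Pi.one_apply,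
      one_mul, Pi.mulSingle_eq_same, Function.update_self]
  · rw [Pi.mul_apply, Pi.mulSingle_eq_of_ne hc, mul_one, Function.update_of_ne hc]

variable {δ : Type*}

theorem extend_inl_comp {f : α → β} (hf : f.Injective) (m : α → γ) (b : β → γ) (d : δ → γ) :
    Function.extend (Sum.inl ∘ f) m (Sum.elim b d) = Sum.elim (Function.extend f m b) d := by
  rw [hf.extend_comp Sum.inl_injective, Sum.elim_comp_inl]
  funext c
  cases c with
  | inl b => exact Sum.inl_injective.extend_apply _ _ b
  | inr d => exact Function.extend_apply' _ _ _ fun ⟨_, h⟩ => Sum.inl_ne_inr h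

theorem extend_inr_comp {f : α → δ} (hf : f.Injective) (m : α → γ) (b : β → γ) (d : δ → γ) :
    Function.extend (Sum.inr ∘ f) m (Sum.elim b d) = Sum.elim b (Function.extend f m d) := by
  rw [hf.extend_comp Sum.inr_injective, Sum.elim_comp_inr]
  funext c
  cases c with
  | inl b => exact Function.extend_apply' _ _ _ fun ⟨_, h⟩ => Sum.inr_ne_inl h
  | inr d => exact Sum.inr_injective.extend_apply _ _ d

theorem extend_inl_elim (m b : α → γ) (d : δ → γ) :
    Function.extend Sum.inl m (Sum.elim b d) = Sum.elim m d := by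
  rw [← Function.comp_id Sum.inl, extend_inl_comp Function.injective_id, Function.extend_id]

theorem extend_inr_elim (m d : δ → γ) (b : α → γ) :
    Function.extend Sum.inr m (Sum.elim b d) = Sum.elim b m := by
  rw [← Function.comp_id Sum.inr, extend_inr_comp Function.injective_id, Function.extend_id]

end Extend

/-! ### Tensor powers of matrices -/

section PiKronecker

variable {Q n R : Type*} [Fintype Q] [DecidableEq Q] [Fintype n] [DecidableEq n] [CommSemiring R]

/-- The Kronecker product `⨂ᵢ U i` of a family of matrices, its rows and columns being indexed by
families of indices: the action of the operators `U i` on separate qubits. -/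
def piKronecker : (Q → Matrix n n R) →* Matrix (Q → n) (Q → n) R where
  toFun U := Matrix.of fun q r => ∏ i, U i (q i) (r i)
  map_one' := by
    ext q r
    simp only [Matrix.of_apply, Pi.one_apply, Matrix.one_apply, Finset.prod_ite_zero, funext_iff,
      Finset.mem_univ, forall_const, Finset.prod_const_one]
  map_mul' U W := by
    ext q r
    simp only [Matrix.of_apply, Pi.mul_apply, Matrix.mul_apply, Finset.prod_univ_sum,
      Fintype.piFinset_univ, Finset.prod_mul_distrib]

theorem piKronecker_apply (U : Q → Matrix n n R) (q r : Q → n) :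
    piKronecker U q r = ∏ i, U i (q i) (r i) := rfl

theorem piKronecker_mulVec_apply (U : Q → Matrix n n R) (ψ : (Q → n) → R) (q : Q → n) :
    (piKronecker U *ᵥ ψ) q = ∑ r, (∏ i, U i (q i) (r i)) * ψ r := rfl

theorem piKronecker_mulSingle_mulVec (W : Matrix n n R) (i : Q) (ψ : (Q → n) → R) (q : Q → n) :
    (piKronecker (Pi.mulSingle i W) *ᵥ ψ) q = ∑ r, W (q i) r * ψ (Function.update q i r) := by
  rw [piKronecker_mulVec_apply]
  refine (Fintype.sum_of_injective (Function.update q i) (Function.update_injective q i) _ _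
    (fun r hr => ?_) fun r => ?_).symm
  · obtain ⟨j, hji, hj⟩ : ∃ j, j ≠ i ∧ q j ≠ r j := by
      by_contra! h
      exact hr ⟨r i, Function.update_eq_iff.2 ⟨rfl, h⟩⟩
    have hzero : Pi.mulSingle (M := fun _ => Matrix n n R) i W j (q j) (r j) = 0 := by
      rw [Pi.mulSingle_eq_of_ne hji, Matrix.one_apply_ne hj]
    rw [Finset.prod_eq_zero (Finset.mem_univ j) hzero, zero_mul]
  · rw [Finset.prod_eq_single i (fun j _ hji => ?_) fun h => absurd (Finset.mem_univ i) h,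
      Pi.mulSingle_eq_same, Function.update_self]
    rw [Pi.mulSingle_eq_of_ne hji, Function.update_of_ne hji, Matrix.one_apply_eq]

theorem piKronecker_diagonal (d : Q → n → R) :
    piKronecker (fun i => Matrix.diagonal (d i)) = Matrix.diagonal fun q => ∏ i, d i (q i) := by
  ext q r
  simp only [piKronecker_apply, Matrix.diagonal_apply, Finset.prod_ite_zero, funext_iff,
    Finset.mem_univ, forall_const]

end PiKronecker

/-! ### Layers of operations -/

namespace Op

variable {Q B α : Type}

/-- The layer consisting of one operation for each element of a finite type. -/
noncomputable def layer [Fintype α] (F : α → Op Q B) : List (Op Q B) :=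
  List.ofFn (F ∘ (Fintype.equivFin α).symm)

theorem length_layer [Fintype α] (F : α → Op Q B) : (layer F).length = Fintype.card α :=
  List.length_ofFn

variable [DecidableEq Q]

theorem pairwise_layer [Fintype α] {F : α → Op Q B}
    (h : Pairwise fun a a' => Independent (F a) (F a')) :
    (layer F).Pairwise Independent :=
  List.pairwise_ofFn.2 fun _ _ hij => h ((Fintype.equivFin α).symm.injective.ne hij.ne)

theorem pairwise_layer_gate [Fintype α] (U : α → Matrix.unitaryGroup (ZMod 2) ℂ) {f : α → Q}
    (hf : f.Injective) (ctrl : α → Option B) :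
    (layer fun a => gate (U a) (f a) (ctrl a)).Pairwise Independent :=
  pairwise_layer fun _ _ h => by simp [Independent, qubits, reads, writes, hf.ne h]

theorem pairwise_layer_cnot [Fintype α] {s t : α → Q} (hs : s.Injective) (ht : t.Injective)
    (hst : ∀ a a', s a ≠ t a') :
    (layer fun a => (cnot (s a) (t a) (hst a a) none : Op Q B)).Pairwise Independent :=
  pairwise_layer fun _ _ h => by
    simp [Independent, qubits, reads, writes, hs.ne h.symm, ht.ne h.symm, hst,
      fun a a' => (hst a a').symm]

theorem pairwise_layer_measure [Fintype α] {f : α → Q} (hf : f.Injective) {g : α → B}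
    (hg : g.Injective) : (layer fun a => measure (f a) (g a)).Pairwise Independent :=
  pairwise_layer fun _ _ h => by simp [Independent, qubits, reads, writes, hf.ne h, hg.ne h]

theorem pairwise_layer_parity [Fintype α] {S : α → Finset B} {g : α → B} (hg : g.Injective)
    (hS : ∀ a a', g a' ∉ S a) :
    (layer fun a => (parity (S a) (g a) : Op Q B)).Pairwise Independent :=
  pairwise_layer fun _ _ h => by simp [Independent, qubits, reads, writes, hg.ne h, hS]

theorem applyGate_eq_piKronecker [Fintype Q] (U : Matrix (ZMod 2) (ZMod 2) ℂ) (i : Q)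
    (ψ : (Q → ZMod 2) → ℂ) :
    applyGate U i ψ = piKronecker (Pi.mulSingle i U) *ᵥ ψ := by
  funext q
  rw [piKronecker_mulSingle_mulVec, applyGate]

variable [DecidableEq B]

theorem prob_gate_cons [Fintype Q] (E : Set (B → ZMod 2)) (os : List (Op Q B))
    (U : Matrix.unitaryGroup (ZMod 2) ℂ) (i : Q) (ctrl : Option B) (b : B → ZMod 2)
    (ψ : (Q → ZMod 2) → ℂ) :
    prob E (gate U i ctrl :: os) ⟨b, ψ⟩ =
      prob E os ⟨b, piKronecker (Pi.mulSingle i (if fires ctrl b then U.1 else 1)) *ᵥ ψ⟩ := by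
  simp only [prob, step, List.map_cons, List.map_nil, List.sum_cons, List.sum_nil, add_zero]
  split_ifs with h
  · rw [applyGate_eq_piKronecker]
  · rw [Pi.mulSingle_one, map_one, Matrix.one_mulVec]

theorem prob_ofFn_gate [Fintype Q] (E : Set (B → ZMod 2)) (os : List (Op Q B)) {n : ℕ}
    (U : Fin n → Matrix.unitaryGroup (ZMod 2) ℂ) {f : Fin n → Q} (hf : f.Injective)
    (ctrl : Fin n → Option B) (b : B → ZMod 2) (ψ : (Q → ZMod 2) → ℂ) :
    prob E (List.ofFn (fun i => gate (U i) (f i) (ctrl i)) ++ os) ⟨b, ψ⟩ =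
      prob E os ⟨b, piKronecker
        (Function.extend f (fun i => if fires (ctrl i) b then (U i).1 else 1) 1) *ᵥ ψ⟩ := by
  induction n generalizing ψ with
  | zero =>
    rw [List.ofFn_zero, List.nil_append, Function.extend_of_isEmpty, map_one, Matrix.one_mulVec]
  | succ n ih =>
    rw [List.ofFn_succ, List.cons_append, prob_gate_cons]
    refine (ih _ (hf.comp (Fin.succ_injective n)) _ _).trans ?_
    rw [Matrix.mulVec_mulVec, ← map_mul, ← extend_fin_succ_mul_mulSingle hf]
    rfl

theorem prob_layer_gate [Fintype Q] [Fintype α] (E : Set (B → ZMod 2)) (os : List (Op Q B))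
    (U : α → Matrix.unitaryGroup (ZMod 2) ℂ) {f : α → Q} (hf : f.Injective)
    (ctrl : α → Option B) (b : B → ZMod 2) (ψ : (Q → ZMod 2) → ℂ) :
    prob E (layer (fun a => gate (U a) (f a) (ctrl a)) ++ os) ⟨b, ψ⟩ =
      prob E os ⟨b, piKronecker
        (Function.extend f (fun a => if fires (ctrl a) b then (U a).1 else 1) 1) *ᵥ ψ⟩ := by
  rw [← extend_comp_equiv (Fintype.equivFin α).symm hf]
  exact prob_ofFn_gate E os _ (hf.comp (Equiv.injective _)) _ b ψ

theorem prob_ofFn_cnot [Fintype Q] (E : Set (B → ZMod 2)) (os : List (Op Q B)) {n : ℕ}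
    {s t : Fin n → Q} (ht : t.Injective) (hst : ∀ i j, s i ≠ t j) (b : B → ZMod 2)
    (ψ : (Q → ZMod 2) → ℂ) :
    prob E (List.ofFn (fun i => cnot (s i) (t i) (hst i i) none) ++ os) ⟨b, ψ⟩ =
      prob E os ⟨b, fun q => ψ (Function.extend t (fun i => q (t i) + q (s i)) q)⟩ := by
  induction n generalizing ψ with
  | zero => simp only [List.ofFn_zero, List.nil_append, Function.extend_of_isEmpty]
  | succ n ih =>
    rw [List.ofFn_succ, List.cons_append, prob]
    simp only [step, fires, if_true, List.map_cons, List.map_nil, List.sum_cons, List.sum_nil,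
      add_zero]
    refine (ih (ht.comp (Fin.succ_injective n)) (fun i j => hst i.succ j.succ) _).trans ?_
    congr 2
    funext q
    rw [applyCnot, Function.extend_apply' _ _ _ (notMem_range_comp_fin_succ ht),
      Function.extend_apply' _ _ _ fun ⟨j, hj⟩ => hst 0 j.succ hj.symm, ← update_extend_fin_succ ht]
    rfl

theorem prob_layer_cnot [Fintype Q] [Fintype α] (E : Set (B → ZMod 2)) (os : List (Op Q B))
    {s t : α → Q} (ht : t.Injective) (hst : ∀ a a', s a ≠ t a') (b : B → ZMod 2)
    (ψ : (Q → ZMod 2) → ℂ) :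
    prob E (layer (fun a => cnot (s a) (t a) (hst a a) none) ++ os) ⟨b, ψ⟩ =
      prob E os ⟨b, fun q => ψ (Function.extend t (fun a => q (t a) + q (s a)) q)⟩ := by
  simp only [← extend_comp_equiv (Fintype.equivFin α).symm ht]
  exact prob_ofFn_cnot E os (ht.comp (Equiv.injective _)) (fun i j => hst _ _) b ψ

theorem prob_ofFn_measure [Fintype Q] (E : Set (B → ZMod 2)) (os : List (Op Q B)) {n : ℕ}
    (f : Fin n → Q) {g : Fin n → B} (hg : g.Injective) (b : B → ZMod 2)
    (ψ : (Q → ZMod 2) → ℂ) :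
    prob E (List.ofFn (fun i => measure (f i) (g i)) ++ os) ⟨b, ψ⟩ =
      ∑ m : Fin n → ZMod 2, prob E os ⟨Function.extend g m b,
        fun q => if ∀ i, q (f i) = m i then ψ q else 0⟩ := by
  induction n generalizing b ψ with
  | zero => simp only [List.ofFn_zero, List.nil_append, Fintype.sum_unique,
      Function.extend_of_isEmpty, IsEmpty.forall_iff, if_true]
  | succ n ih =>
    have hbranch (r : ZMod 2) :
        prob E (List.ofFn (fun i : Fin n => measure (f i.succ) (g i.succ)) ++ os)
          ⟨Function.update b (g 0) r, project (f 0) r ψ⟩ =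
        ∑ m : Fin n → ZMod 2, prob E os ⟨Function.extend g (Fin.cons r m) b,
          fun q => if ∀ i, q (f i) = (Fin.cons r m : Fin (n + 1) → ZMod 2) i then ψ q else 0⟩ := by
      refine (ih (f ∘ Fin.succ) (hg.comp (Fin.succ_injective n)) _ _).trans
        (Finset.sum_congr rfl fun m _ => ?_)
      rw [← extend_fin_succ_update hg (Fin.cons r m)]
      simp only [Fin.forall_fin_succ, Fin.cons_zero, Fin.cons_succ, project, Function.comp_apply,
        ← ite_and, and_comm]
      rfl
    rw [List.ofFn_succ, List.cons_append, prob]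
    simp only [step, List.map_cons, List.map_nil, List.sum_cons, List.sum_nil, add_zero, hbranch]
    rw [← (Fin.consEquiv fun _ => ZMod 2).sum_comp, Fintype.sum_prod_type, sum_zmod_two]
    rfl

theorem prob_layer_measure [Fintype Q] [Fintype α] [DecidableEq α] (E : Set (B → ZMod 2))
    (os : List (Op Q B)) (f : α → Q) {g : α → B} (hg : g.Injective) (b : B → ZMod 2)
    (ψ : (Q → ZMod 2) → ℂ) :
    prob E (layer (fun a => measure (f a) (g a)) ++ os) ⟨b, ψ⟩ =
      ∑ m : α → ZMod 2, prob E os ⟨Function.extend g m b,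
        fun q => if ∀ a, q (f a) = m a then ψ q else 0⟩ := by
  let e := (Fintype.equivFin α).symm
  rw [← (e.arrowCongr (Equiv.refl (ZMod 2))).sum_comp]
  refine (prob_ofFn_measure E os (f ∘ e) (hg.comp e.injective) b ψ).trans
    (Finset.sum_congr rfl fun m _ => ?_)
  rw [← extend_comp_equiv e hg]
  simp only [← e.forall_congr_right (q := fun _ => _ = _), Function.comp_def,
    Equiv.arrowCongr_apply, Equiv.symm_apply_apply, Equiv.refl_apply]

theorem prob_ofFn_parity [Fintype Q] (E : Set (B → ZMod 2)) (os : List (Op Q B)) {n : ℕ}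
    {S : Fin n → Finset B} {g : Fin n → B} (hg : g.Injective) (hS : ∀ i j, g j ∉ S i)
    (b : B → ZMod 2) (ψ : (Q → ZMod 2) → ℂ) :
    prob E (List.ofFn (fun i => parity (S i) (g i)) ++ os) ⟨b, ψ⟩ =
      prob E os ⟨Function.extend g (fun i => ∑ β ∈ S i, b β) b, ψ⟩ := by
  induction n generalizing b with
  | zero => rw [List.ofFn_zero, List.nil_append, Function.extend_of_isEmpty]
  | succ n ih =>
    rw [List.ofFn_succ, List.cons_append, prob]
    simp only [step, List.map_cons, List.map_nil, List.sum_cons, List.sum_nil, add_zero]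
    refine (ih (hg.comp (Fin.succ_injective n)) (fun i j => hS i.succ j.succ) _).trans ?_
    rw [← extend_fin_succ_update hg]
    congr 3
    funext i
    exact Finset.sum_congr rfl fun β hβ =>
      Function.update_of_ne (ne_of_mem_of_not_mem hβ (hS i.succ 0)) _ _

theorem prob_layer_parity [Fintype Q] [Fintype α] (E : Set (B → ZMod 2)) (os : List (Op Q B))
    {S : α → Finset B} {g : α → B} (hg : g.Injective) (hS : ∀ a a', g a' ∉ S a)
    (b : B → ZMod 2) (ψ : (Q → ZMod 2) → ℂ) :
    prob E (layer (fun a => parity (S a) (g a)) ++ os) ⟨b, ψ⟩ =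
      prob E os ⟨Function.extend g (fun a => ∑ β ∈ S a, b β) b, ψ⟩ := by
  rw [← extend_comp_equiv (Fintype.equivFin α).symm hg]
  exact prob_ofFn_parity E os (hg.comp (Equiv.injective _)) (fun i j => hS _ _) b ψ

end Op

/-! ### Parity layers -/

namespace Op

variable {Q B α β : Type} [Fintype α] [Fintype β]

/-- The layer of parity gates that multiplies the bits `read` by the matrix `A` and writes the
product to the bits `write`. -/
noncomputable def parityLayer (A : Matrix α β (ZMod 2)) (read : β ↪ B) (write : α → B) :
    List (Op Q B) :=
  layer fun a => parity (({c | A a c = 1} : Finset β).map read) (write a)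

theorem pairwise_parityLayer [DecidableEq Q] (A : Matrix α β (ZMod 2)) {read : β ↪ B}
    {write : α → B} (hwrite : write.Injective) (h : ∀ a c, write a ≠ read c) :
    (parityLayer A read write : List (Op Q B)).Pairwise Independent :=
  pairwise_layer_parity hwrite fun a a' ha' => by
    obtain ⟨c, -, hc⟩ := mem_map.1 ha'
    exact h a' c hc.symm

theorem prob_parityLayer [Fintype Q] [DecidableEq Q] [DecidableEq B] (E : Set (B → ZMod 2))
    (os : List (Op Q B)) (A : Matrix α β (ZMod 2)) {read : β ↪ B} {write : α → B}
    (hwrite : write.Injective) (h : ∀ a c, write a ≠ read c) (b : B → ZMod 2)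
    (ψ : (Q → ZMod 2) → ℂ) :
    prob E (parityLayer A read write ++ os) ⟨b, ψ⟩ =
      prob E os ⟨Function.extend write (A *ᵥ (b ∘ read)) b, ψ⟩ := by
  have hmulVec (a : α) :
      ∑ β ∈ ({c | A a c = 1} : Finset β).map read, b β = (A *ᵥ (b ∘ read)) a := by
    rw [sum_map, sum_filter]
    refine Finset.sum_congr rfl fun c _ => ?_
    rcases zmod_two_eq_zero_or_one (A a c) with hc | hc <;> simp [hc]
  rw [parityLayer, prob_layer_parity E os hwrite fun a a' ha' => ?_]
  · simp only [hmulVec]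
  · obtain ⟨c, -, hc⟩ := mem_map.1 ha'
    exact h a' c hc.symm

end Op

/-! ### Data and ancilla registers -/

section Registers

variable {V D n R : Type*} [Fintype D] [DecidableEq n]

/-- The state `φ ⊗ |s⟩` of a data register `V` in the state `φ` and an ancilla register `D` in the
basis state `s`. -/
def tensorKet [Zero R] (φ : (V → n) → R) (s : D → n) : (V ⊕ D → n) → R :=
  fun q => if q ∘ Sum.inr = s then φ (q ∘ Sum.inl) else 0

theorem sum_tensorKet [Fintype V] [DecidableEq V] [DecidableEq D] [Fintype n] {M : Type*}
    [AddCommMonoid M] [Zero R] (φ : (V → n) → R) (s : D → n) (F : (V ⊕ D → n) → R → M)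
    (hF : ∀ q, F q 0 = 0) :
    ∑ q, F q (tensorKet φ s q) = ∑ a, F (Sum.elim a s) (φ a) := by
  rw [← (Equiv.sumArrowEquivProdArrow V D n).symm.sum_comp, Fintype.sum_prod_type]
  refine Finset.sum_congr rfl fun a _ => ?_
  refine (Finset.sum_eq_single s (fun s' _ hs' => ?_) (by simp)).trans ?_
  · exact (congrArg _ (if_neg hs')).trans (hF _)
  · exact congrArg _ (if_pos rfl)

theorem piKronecker_sumElim_one_mulVec_tensorKet [Fintype V] [DecidableEq V] [DecidableEq D]
    [Fintype n] [CommSemiring R] (U : V → Matrix n n R) (φ : (V → n) → R) (s : D → n) :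
    piKronecker (Sum.elim U 1) *ᵥ tensorKet φ s = tensorKet (piKronecker U *ᵥ φ) s := by
  funext q
  rw [piKronecker_mulVec_apply, sum_tensorKet φ s (fun r x => (∏ i, Sum.elim U 1 i (q i) (r i)) * x)
    fun _ => mul_zero _]
  simp only [Fintype.prod_sum_type, Sum.elim_inl, Sum.elim_inr, Pi.one_apply, Matrix.one_apply,
    Finset.prod_ite_zero, Finset.prod_const_one, mem_univ, forall_const]
  rw [tensorKet, piKronecker_mulVec_apply]
  simp only [funext_iff, Function.comp_apply]
  split_ifs
  · simp only [mul_one]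
  · simp only [mul_zero, zero_mul, Finset.sum_const_zero]

theorem tensorKet_pi_single_zero [Fintype V] [Zero n] [Zero R] [One R] :
    tensorKet (Pi.single 0 1) 0 = (Pi.single 0 1 : (V ⊕ D → n) → R) := by
  funext q
  simp only [tensorKet, Pi.single_apply, ← ite_and]
  congr 1
  simp only [funext_iff, Sum.forall, Function.comp_apply, Pi.zero_apply, and_comm]

end Registers

theorem Branch.weight_tensorKet {V D B : Type} [Fintype V] [Fintype D] [DecidableEq V]
    [DecidableEq D] (b : B → ZMod 2) (φ : (V → ZMod 2) → ℂ) (s : D → ZMod 2) :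
    (⟨b, tensorKet φ s⟩ : Branch (V ⊕ D) B).weight = ∑ a, ‖φ a‖ ^ 2 :=
  sum_tensorKet φ s (fun _ x => ‖x‖ ^ 2) fun _ => by simp

namespace Op

variable {V D B α : Type} [Fintype V] [Fintype D] [DecidableEq V] [DecidableEq D] [DecidableEq B]

theorem prob_layer_gate_inl [Fintype α] (E : Set (B → ZMod 2)) (os : List (Op (V ⊕ D) B))
    (U : α → Matrix.unitaryGroup (ZMod 2) ℂ) {f : α → V} (hf : f.Injective)
    (ctrl : α → Option B) (b : B → ZMod 2) (φ : (V → ZMod 2) → ℂ) (s : D → ZMod 2) :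
    prob E (layer (fun a => gate (U a) (Sum.inl (f a)) (ctrl a)) ++ os) ⟨b, tensorKet φ s⟩ =
      prob E os ⟨b, tensorKet (piKronecker
        (Function.extend f (fun a => if fires (ctrl a) b then (U a).1 else 1) 1) *ᵥ φ) s⟩ := by
  rw [← piKronecker_sumElim_one_mulVec_tensorKet, ← extend_inl_comp hf, Sum.elim_one_one]
  exact prob_layer_gate E os U (Sum.inl_injective.comp hf) ctrl b _

theorem prob_layer_measure_inl (E : Set (B → ZMod 2)) (os : List (Op (V ⊕ D) B)) {g : V → B}
    (hg : g.Injective) (b : B → ZMod 2) (φ : (V → ZMod 2) → ℂ) (s : D → ZMod 2) :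
    prob E (layer (fun v => measure (Sum.inl v) (g v)) ++ os) ⟨b, tensorKet φ s⟩ =
      ∑ m, prob E os ⟨Function.extend g m b, tensorKet (Pi.single m (φ m)) s⟩ := by
  rw [prob_layer_measure E os _ hg]
  refine Finset.sum_congr rfl fun m _ => ?_
  congr 2
  funext q
  simp only [tensorKet, Pi.single_apply, funext_iff, Function.comp_apply]
  split_ifs with hm hs
  · rw [show q ∘ Sum.inl = m from funext hm]
  all_goals rfl

theorem prob_layer_measure_inr (E : Set (B → ZMod 2)) (os : List (Op (V ⊕ D) B)) {g : D → B}
    (hg : g.Injective) (b : B → ZMod 2) (ψ : (V ⊕ D → ZMod 2) → ℂ) :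
    prob E (layer (fun u => measure (Sum.inr u) (g u)) ++ os) ⟨b, ψ⟩ =
      ∑ s, prob E os ⟨Function.extend g s b, tensorKet (fun a => ψ (Sum.elim a s)) s⟩ := by
  rw [prob_layer_measure E os _ hg]
  refine Finset.sum_congr rfl fun s _ => ?_
  congr 2
  funext q
  rw [tensorKet]
  simp only [funext_iff, Function.comp_apply]
  split_ifs with hs
  · rw [← show q ∘ Sum.inr = s from funext hs, Sum.elim_comp_inl_inr]
  · rfl

end Op

/-! ### Layers of CNOT gates -/

section Cnot

variable {V D : Type}

/-- The linear map computed by CNOT gates onto the ancillas `u : D`, each controlled by the data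
qubit `f u`, or absent if `f u = none`. -/
def wireMap (f : D → Option V) : (V → ZMod 2) →ₗ[ZMod 2] (D → ZMod 2) :=
  LinearMap.pi fun u => (f u).elim 0 LinearMap.proj

theorem wireMap_apply (f : D → Option V) (a : V → ZMod 2) (u : D) :
    wireMap f a u = (f u).elim 0 a := by
  rw [wireMap, LinearMap.pi_apply]
  cases f u <;> rfl

namespace Op

variable {B : Type} [Fintype D]

/-- The layer of CNOT gates onto the ancillas `u : D`, each controlled by the data qubit `f u`, or
absent if `f u = none`. -/
noncomputable def cnotLayer (f : D → Option V) : List (Op (V ⊕ D) B) :=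
  layer fun u : {u // (f u).isSome} =>
    cnot (Sum.inl ((f u).get u.2)) (Sum.inr u) Sum.inl_ne_inr none

theorem length_cnotLayer_le (f : D → Option V) :
    (cnotLayer f : List (Op (V ⊕ D) B)).length ≤ Fintype.card D := by
  rw [cnotLayer, length_layer]
  exact Fintype.card_subtype_le _

variable [DecidableEq V] [DecidableEq D]

theorem pairwise_cnotLayer {f : D → Option V}
    (hf : ∀ u u' v, f u = some v → f u' = some v → u = u') :
    (cnotLayer f : List (Op (V ⊕ D) B)).Pairwise Independent :=
  pairwise_layer_cnot
    (fun u u' h => Subtype.ext (hf u u' _ (Option.eq_some_of_isSome u.2)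
      ((Option.eq_some_of_isSome u'.2).trans (congrArg some (Sum.inl_injective h).symm))))
    (Sum.inr_injective.comp Subtype.val_injective) fun _ _ => Sum.inl_ne_inr

variable [Fintype V] [DecidableEq B]

theorem prob_cnotLayer (E : Set (B → ZMod 2)) (os : List (Op (V ⊕ D) B)) (f : D → Option V)
    (b : B → ZMod 2) (ψ : (V ⊕ D → ZMod 2) → ℂ) :
    prob E (cnotLayer f ++ os) ⟨b, ψ⟩ = prob E os ⟨b, fun q =>
      ψ (Sum.elim (q ∘ Sum.inl) (q ∘ Sum.inr + wireMap f (q ∘ Sum.inl)))⟩ := by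
  refine (prob_layer_cnot E os (Sum.inr_injective.comp Subtype.val_injective)
    (fun _ _ => Sum.inl_ne_inr) b ψ).trans ?_
  congr 2
  funext q
  congr 1
  refine (congrArg (Function.extend _ _) (Sum.elim_comp_inl_inr q).symm).trans
    ((extend_inr_comp Subtype.val_injective _ _ _).trans (congrArg (Sum.elim _) ?_))
  funext u
  rw [Pi.add_apply, wireMap_apply]
  cases hu : f u with
  | none =>
    rw [Function.extend_apply' _ _ _ (by simp [hu]), Option.elim_none, add_zero]
  | some v =>
    have hsome : (f u).isSome := Option.isSome_of_eq_some hu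
    rw [Subtype.val_injective.extend_apply _ _ ⟨u, hsome⟩, Option.elim_some]
    simp only [hu, Function.comp_apply, Option.get_some]

theorem prob_flatten_cnotLayer (E : Set (B → ZMod 2)) (os : List (Op (V ⊕ D) B))
    (wires : List (D → Option V)) (b : B → ZMod 2) (ψ : (V ⊕ D → ZMod 2) → ℂ) :
    prob E ((wires.map cnotLayer).flatten ++ os) ⟨b, ψ⟩ = prob E os ⟨b, fun q =>
      ψ (Sum.elim (q ∘ Sum.inl) (q ∘ Sum.inr + (wires.map wireMap).sum (q ∘ Sum.inl)))⟩ := by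
  induction wires generalizing ψ with
  | nil => simp only [List.map_nil, List.flatten_nil, List.nil_append, List.sum_nil,
      LinearMap.zero_apply, add_zero, Sum.elim_comp_inl_inr]
  | cons f wires ih =>
    rw [List.map_cons, List.flatten_cons, List.append_assoc, prob_cnotLayer, ih]
    simp only [Sum.elim_comp_inl, Sum.elim_comp_inr, List.map_cons, List.sum_cons,
      LinearMap.add_apply, add_assoc, add_comm (wireMap f _)]

end Op

end Cnot

/-! ### Signs and gates -/

/-- The sign character `a ↦ (-1)ᵃ` of `𝔽₂`. -/
def sgn : AddChar (ZMod 2) ℝ := AddChar.zmodChar 2 (ζ := -1) (by norm_num)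

theorem sgn_one : sgn 1 = -1 := by
  rw [sgn, AddChar.zmodChar_apply, ZMod.val_one, pow_one]

theorem sgn_sum {α : Type*} (s : Finset α) (f : α → ZMod 2) :
    sgn (∑ i ∈ s, f i) = ∏ i ∈ s, sgn (f i) :=
  map_prod sgn.toMonoidHom (fun i => Multiplicative.ofAdd (f i)) s

section Fourier

variable {κ : Type*} [Fintype κ] [DecidableEq κ]

theorem sum_sgn_dotProduct (u : κ → ZMod 2) :
    ∑ S : κ → ZMod 2, sgn (S ⬝ᵥ u) = if u = 0 then 2 ^ Fintype.card κ else 0 := by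
  have hfactor (i : κ) : ∑ r : ZMod 2, sgn (r * u i) = if u i = 0 then 2 else 0 := by
    rw [sum_zmod_two, zero_mul, one_mul, AddChar.map_zero_eq_one]
    rcases zmod_two_eq_zero_or_one (u i) with h | h
    · rw [h, AddChar.map_zero_eq_one, if_pos rfl, one_add_one_eq_two]
    · rw [h, sgn_one, add_neg_cancel, if_neg one_ne_zero]
  simp only [dotProduct, sgn_sum]
  rw [← Fintype.piFinset_univ, ← Finset.prod_univ_sum (fun _ => univ) fun i r => sgn (r * u i)]
  simp only [hfactor, Finset.prod_ite_zero, funext_iff, mem_univ, forall_const,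
    Finset.prod_const, Pi.zero_apply, card_univ]

theorem sum_mul_sgn_mul_sgn (g : (κ → ZMod 2) → ℝ) (z : κ → ZMod 2) :
    ∑ S, ∑ w, g w * (sgn (S ⬝ᵥ w) * sgn (S ⬝ᵥ z)) = 2 ^ Fintype.card κ * g z := by
  have horth (w : κ → ZMod 2) : ∑ S, sgn (S ⬝ᵥ w) * sgn (S ⬝ᵥ z) =
      if w = z then 2 ^ Fintype.card κ else 0 := by
    simp only [← AddChar.map_add_eq_mul, ← dotProduct_add, sum_sgn_dotProduct]
    exact if_congr (by rw [← ZModModule.sub_eq_add, sub_eq_zero]) rfl rfl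
  rw [Finset.sum_comm]
  simp only [← Finset.mul_sum, horth, mul_ite, mul_zero, Finset.sum_ite_eq', mem_univ, if_true]
  exact mul_comm _ _

end Fourier

/-- The Hadamard gate. -/
noncomputable def hadamardGate : Matrix.unitaryGroup (ZMod 2) ℂ :=
  ⟨Matrix.of fun a b => (((√2)⁻¹ * sgn (a * b) : ℝ) : ℂ), by
    have h2 : (((√2 : ℝ) : ℂ))⁻¹ * (((√2 : ℝ) : ℂ))⁻¹ = 1 / 2 := by
      rw [← mul_inv, ← Complex.ofReal_mul, Real.mul_self_sqrt zero_le_two, one_div,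
        Complex.ofReal_ofNat]
    rw [Matrix.mem_unitaryGroup_iff]
    ext i j
    rw [Matrix.mul_apply, sum_zmod_two]
    rcases zmod_two_eq_zero_or_one i with rfl | rfl <;>
      rcases zmod_two_eq_zero_or_one j with rfl | rfl <;>
      simp [sgn_one, Matrix.star_apply, h2] <;> norm_num⟩

/-- The Pauli `X` gate. -/
noncomputable def notGate : Matrix.unitaryGroup (ZMod 2) ℂ :=
  ⟨Matrix.of fun a b => if b = a + 1 then 1 else 0, by
    rw [Matrix.mem_unitaryGroup_iff]
    ext i j
    rw [Matrix.mul_apply, sum_zmod_two]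
    rcases zmod_two_eq_zero_or_one i with rfl | rfl <;>
      rcases zmod_two_eq_zero_or_one j with rfl | rfl <;>
      simp [Matrix.star_apply, show (1 : ZMod 2) + 1 = 0 from rfl]⟩

/-- The phase `e^{± it}` acquired by the basis state `a` under the rotation by `t`. -/
noncomputable def phase (t : ℝ) (a : ZMod 2) : ℂ := Complex.exp (((t * sgn a : ℝ) : ℂ) * Complex.I)

/-- The rotation `diag(e^{it}, e^{-it})`. -/
noncomputable def phaseGate (t : ℝ) : Matrix.unitaryGroup (ZMod 2) ℂ :=
  ⟨Matrix.diagonal (phase t), by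
    rw [Matrix.mem_unitaryGroup_iff, Matrix.star_eq_conjTranspose, Matrix.diagonal_conjTranspose,
      Matrix.diagonal_mul_diagonal, ← Matrix.diagonal_one]
    congr 1
    funext a
    rw [Pi.star_apply, RCLike.star_def, Complex.mul_conj, Complex.normSq_eq_norm_sq, phase,
      Complex.norm_exp_ofReal_mul_I, one_pow, Complex.ofReal_one]⟩

section Transforms

variable {V : Type*} [Fintype V] [DecidableEq V]

/-- The normalized Fourier transform of a state over `𝔽₂`. -/
noncomputable def hadamardTransform (φ : (V → ZMod 2) → ℂ) (m : V → ZMod 2) : ℂ :=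
  ((√2)⁻¹ ^ Fintype.card V : ℝ) * ∑ a, (sgn (m ⬝ᵥ a) : ℂ) * φ a

theorem piKronecker_hadamardGate_mulVec (φ : (V → ZMod 2) → ℂ) :
    piKronecker (fun _ => hadamardGate.1) *ᵥ φ = hadamardTransform φ := by
  funext m
  rw [piKronecker_mulVec_apply, hadamardTransform, Finset.mul_sum]
  refine Finset.sum_congr rfl fun a _ => ?_
  have hprod : ∏ v, hadamardGate.1 (m v) (a v) =
      (((√2)⁻¹ ^ Fintype.card V * sgn (m ⬝ᵥ a) : ℝ) : ℂ) := by
    rw [dotProduct, sgn_sum, ← card_univ, ← Finset.prod_const, ← Finset.prod_mul_distrib,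
      Complex.ofReal_prod]
    rfl
  rw [hprod, Complex.ofReal_mul, mul_assoc]

theorem notGate_controlled_apply (r a b : ZMod 2) :
    (if decide (r = 1) then notGate.1 else 1) a b = if b = a + r then 1 else 0 := by
  rcases zmod_two_eq_zero_or_one r with rfl | rfl
  · rw [add_zero]
    exact Matrix.one_apply.trans (if_congr eq_comm rfl rfl)
  · rfl

theorem piKronecker_notGate_mulVec (r : V → ZMod 2) (φ : (V → ZMod 2) → ℂ) :
    piKronecker (fun v => if decide (r v = 1) then notGate.1 else 1) *ᵥ φ = fun a => φ (a + r) := by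
  funext a
  simp only [piKronecker_mulVec_apply, notGate_controlled_apply, Finset.prod_ite_zero, mem_univ,
    forall_const, Finset.prod_const_one, ← Pi.add_apply, ← funext_iff, ite_mul, one_mul, zero_mul,
    Finset.sum_ite_eq', if_true]

theorem piKronecker_phaseGate_mulVec {α : Type*} [Fintype α] {site : α → V}
    (hsite : site.Injective) (θ : α → ℝ) (c : α → Bool) (φ : (V → ZMod 2) → ℂ) :
    piKronecker (Function.extend site (fun r => if c r then (phaseGate (θ r)).1 else 1) 1) *ᵥ φ =
      fun a => (∏ r, if c r then phase (θ r) (a (site r)) else 1) * φ a := by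
  have hdiag : Function.extend site (fun r => if c r then (phaseGate (θ r)).1 else 1) 1 =
      fun v => Matrix.diagonal
        (Function.extend site (fun r => if c r then phase (θ r) else 1) 1 v) := by
    funext v
    rw [Function.apply_extend Matrix.diagonal]
    congr 1
    funext r
    rw [Function.comp_apply, apply_ite Matrix.diagonal]
    rfl
  rw [hdiag, piKronecker_diagonal]
  funext a
  rw [Matrix.mulVec_diagonal]
  congr 1
  refine (Fintype.prod_of_injective site hsite _ _ (fun v hv => ?_) fun r => ?_).symm
  · rw [Function.extend_apply' _ _ _ hv, Pi.one_apply, Pi.one_apply]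
  · rw [hsite.extend_apply, apply_ite (fun d : ZMod 2 → ℂ => d (a (site r))), Pi.one_apply]

end Transforms

/-! ### Networks of parity checks -/

theorem card_fiber_mul_card {G H : Type*} [AddGroup G] [AddGroup H] [Fintype G] [Fintype H]
    [DecidableEq H] (f : G →+ H) (hf : Function.Surjective f) (x : H) :
    #{g | f g = x} * Fintype.card H = Fintype.card G :=
  calc #{g | f g = x} * Fintype.card H = ∑ x', #{g | f g = x'} := by
        rw [Finset.sum_congr rfl fun x' _ =>
          AddMonoidHom.card_fiber_eq_of_mem_range f (hf x') (hf x), Finset.sum_const, card_univ,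
          smul_eq_mul, mul_comm]
    _ = Fintype.card G :=
        (card_eq_sum_card_fiberwise (s := univ) (t := univ) fun g _ => mem_univ (f g)).symm

/-- A network of parity checks, one for each ancilla in `D`, on data qubits `V`. The checks are
computed by layers of CNOT gates with the controls `wires`; together with free coordinates indexed
by `κ` they form linear coordinates on the strings `V → ZMod 2`. -/
structure ParityNetwork (κ V D : Type) where
  wires : List (D → Option V)
  wires_injective : ∀ f ∈ wires, ∀ u u' v, f u = some v → f u' = some v → u = u'
  coord : (V → ZMod 2) ≃ₗ[ZMod 2] (κ → ZMod 2) × (D → ZMod 2)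
  coord_snd : ∀ a, (coord a).2 = (wires.map wireMap).sum a

namespace ParityNetwork

variable {κ V D ι R : Type} (M : ParityNetwork κ V D)

section Coordinates

variable [Fintype κ] [DecidableEq κ]

/-- The matrix sending the free coordinates to the string that passes all checks. -/
def encode : Matrix V κ (ZMod 2) :=
  LinearMap.toMatrix' (M.coord.symm.toLinearMap ∘ₗ LinearMap.inl _ _ _)

theorem encode_mulVec (z : κ → ZMod 2) : M.encode *ᵥ z = M.coord.symm (z, 0) :=
  LinearMap.toMatrix'_mulVec _ z

theorem surjective_encode_transpose_mulVec [Fintype V] :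
    Function.Surjective fun m => M.encodeᵀ *ᵥ m := by
  classical
  let P : Matrix κ V (ZMod 2) :=
    LinearMap.toMatrix' (LinearMap.fst _ _ _ ∘ₗ M.coord.toLinearMap)
  have hP : P * M.encode = 1 := by
    refine Matrix.ext_of_mulVec_single fun i => ?_
    rw [← Matrix.mulVec_mulVec, encode_mulVec, LinearMap.toMatrix'_mulVec, one_mulVec]
    exact congrArg Prod.fst (M.coord.apply_symm_apply _)
  intro x
  refine ⟨Pᵀ *ᵥ x, ?_⟩
  dsimp only
  rw [Matrix.mulVec_mulVec, ← Matrix.transpose_mul, hP, Matrix.transpose_one, one_mulVec]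

theorem sum_encode_mulVec [Fintype V] [DecidableEq V] [Fintype D] {A : Type*}
    [AddCommMonoid A] (F : (V → ZMod 2) → A) :
    ∑ a, (if (M.coord a).2 = 0 then F a else 0) = ∑ z, F (M.encode *ᵥ z) := by
  classical
  rw [← M.coord.symm.toEquiv.sum_comp, Fintype.sum_prod_type]
  simp only [LinearEquiv.coe_toEquiv, LinearEquiv.apply_symm_apply, Finset.sum_ite_eq', mem_univ,
    if_true, encode_mulVec]

theorem hadamardTransform_codeword [Fintype V] [DecidableEq V] [Fintype D] (F : (V → ZMod 2) → ℂ)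
    (c : ℂ) (m : V → ZMod 2) :
    hadamardTransform (fun a => F a * if (M.coord a).2 = 0 then c else 0) m =
      ((√2)⁻¹ ^ Fintype.card V : ℝ) * c *
        ∑ z, (sgn ((M.encodeᵀ *ᵥ m) ⬝ᵥ z) : ℂ) * F (M.encode *ᵥ z) := by
  rw [hadamardTransform, mul_assoc]
  congr 1
  simp only [mul_ite, mul_zero]
  rw [M.sum_encode_mulVec fun a => (sgn (m ⬝ᵥ a) : ℂ) * (F a * c), Finset.mul_sum]
  refine Finset.sum_congr rfl fun z _ => ?_
  rw [Matrix.mulVec_transpose, ← Matrix.dotProduct_mulVec]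
  ring

end Coordinates

/-- The matrix sending the outcomes of the checks to a string with these outcomes. -/
def correct [Fintype D] [DecidableEq D] : Matrix V D (ZMod 2) :=
  LinearMap.toMatrix' (M.coord.symm.toLinearMap ∘ₗ LinearMap.inr _ _ _)

theorem coord_add_correct_mulVec [Fintype D] [DecidableEq D] (a : V → ZMod 2) (s : D → ZMod 2) :
    (M.coord (a + M.correct *ᵥ s)).2 = (M.coord a).2 + s := by
  rw [correct, LinearMap.toMatrix'_mulVec, map_add, Prod.snd_add]
  exact congrArg (_ + Prod.snd ·) (M.coord.apply_symm_apply _)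

theorem card_eq [Fintype V] [Fintype κ] [Fintype D] (M : ParityNetwork κ V D) :
    Fintype.card V = Fintype.card κ + Fintype.card D := by
  simpa only [Module.finrank_prod, Module.finrank_pi] using LinearEquiv.finrank_eq M.coord

theorem card_encode_transpose_mulVec_eq [Fintype V] [DecidableEq V] [Fintype κ] [DecidableEq κ]
    [Fintype D] (x : κ → ZMod 2) : #{m | M.encodeᵀ *ᵥ m = x} = 2 ^ Fintype.card D := by
  have h := card_fiber_mul_card (Matrix.mulVecLin M.encodeᵀ).toAddMonoidHom
    M.surjective_encode_transpose_mulVec x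
  rw [Fintype.card_fun, Fintype.card_fun, ZMod.card, M.card_eq, pow_add, mul_comm] at h
  exact Nat.eq_of_mul_eq_mul_left (by positivity) h

/-- The bits holding the outcomes of the checks. -/
def syndrome : D ↪ ι ⊕ (D ⊕ V ⊕ V ⊕ κ) := Function.Embedding.inl.trans .inr

/-- The bits controlling the corrections. -/
def correction : V ↪ ι ⊕ (D ⊕ V ⊕ V ⊕ κ) :=
  Function.Embedding.inl.trans (Function.Embedding.inr.trans .inr)

/-- The bits holding the outcomes of the final measurement. -/
def outcome : V ↪ ι ⊕ (D ⊕ V ⊕ V ⊕ κ) :=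
  Function.Embedding.inl.trans (Function.Embedding.inr.trans (Function.Embedding.inr.trans .inr))

/-- The output bits. -/
def answer : κ ↪ ι ⊕ (D ⊕ V ⊕ V ⊕ κ) :=
  Function.Embedding.inr.trans (Function.Embedding.inr.trans (Function.Embedding.inr.trans .inr))

section Extend

variable (y : ι → ZMod 2) (s s' : D → ZMod 2) (r r' m m' : V → ZMod 2) (o o' : κ → ZMod 2)

theorem extend_syndrome (w : V ⊕ V ⊕ κ → ZMod 2) :
    Function.extend syndrome s' (Sum.elim y (Sum.elim s w)) = Sum.elim y (Sum.elim s' w) :=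
  (extend_inr_comp Sum.inl_injective _ _ _).trans (by rw [extend_inl_elim])

theorem extend_correction (w : V ⊕ κ → ZMod 2) :
    Function.extend correction r' (Sum.elim y (Sum.elim s (Sum.elim r w))) =
      Sum.elim y (Sum.elim s (Sum.elim r' w)) := by
  refine (extend_inr_comp (Sum.inr_injective.comp Sum.inl_injective) _ _ _).trans ?_
  rw [extend_inr_comp Sum.inl_injective, extend_inl_elim]

theorem extend_outcome :
    Function.extend outcome m' (Sum.elim y (Sum.elim s (Sum.elim r (Sum.elim m o)))) =
      Sum.elim y (Sum.elim s (Sum.elim r (Sum.elim m' o))) := by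
  refine (extend_inr_comp (Sum.inr_injective.comp (Sum.inr_injective.comp Sum.inl_injective))
    _ _ _).trans ?_
  rw [extend_inr_comp (Sum.inr_injective.comp Sum.inl_injective),
    extend_inr_comp Sum.inl_injective, extend_inl_elim]

theorem extend_answer :
    Function.extend answer o' (Sum.elim y (Sum.elim s (Sum.elim r (Sum.elim m o)))) =
      Sum.elim y (Sum.elim s (Sum.elim r (Sum.elim m o'))) := by
  refine (extend_inr_comp (Sum.inr_injective.comp (Sum.inr_injective.comp Sum.inr_injective))
    _ _ _).trans ?_
  rw [extend_inr_comp (Sum.inr_injective.comp Sum.inr_injective),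
    extend_inr_comp Sum.inr_injective, extend_inr_elim]

end Extend

section Layers

variable {B : Type} [Fintype V] [DecidableEq V] [Fintype D] [DecidableEq D] [DecidableEq B]
  (E : Set (B → ZMod 2)) (os : List (Op (V ⊕ D) B)) (b : B → ZMod 2) (φ : (V → ZMod 2) → ℂ)
  (s : D → ZMod 2)

theorem prob_hadamardLayer :
    Op.prob E (Op.layer (fun v => .gate hadamardGate (Sum.inl v) none) ++ os) ⟨b, tensorKet φ s⟩ =
      Op.prob E os ⟨b, tensorKet (hadamardTransform φ) s⟩ := by
  rw [← piKronecker_hadamardGate_mulVec]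
  refine (Op.prob_layer_gate_inl E os _ Function.injective_id (fun _ => none) b φ s).trans ?_
  rw [Function.extend_id]
  rfl

theorem prob_notLayer (g : V → B) :
    Op.prob E (Op.layer (fun v => .gate notGate (Sum.inl v) (some (g v))) ++ os)
        ⟨b, tensorKet φ s⟩ =
      Op.prob E os ⟨b, tensorKet (fun a => φ (a + b ∘ g)) s⟩ := by
  rw [← piKronecker_notGate_mulVec]
  refine (Op.prob_layer_gate_inl E os _ Function.injective_id (fun v => some (g v)) b φ s).trans ?_
  rw [Function.extend_id]
  rfl

theorem prob_phaseLayer [Fintype R] {site : R → V} (hsite : site.Injective) (θ : R → ℝ)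
    (g : R → B) :
    Op.prob E (Op.layer (fun r => .gate (phaseGate (θ r)) (Sum.inl (site r)) (some (g r))) ++ os)
        ⟨b, tensorKet φ s⟩ =
      Op.prob E os ⟨b, tensorKet (fun a =>
        (∏ r, if decide (b (g r) = 1) then phase (θ r) (a (site r)) else 1) * φ a) s⟩ := by
  rw [← piKronecker_phaseGate_mulVec hsite]
  exact Op.prob_layer_gate_inl E os _ hsite (fun r => some (g r)) b φ s

end Layers

section Prepare

variable [Fintype V] [Fintype D] [DecidableEq D]

/-- The layers that prepare a uniform superposition of the strings passing all checks. -/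
noncomputable def prepare : List (List (Op (V ⊕ D) (ι ⊕ (D ⊕ V ⊕ V ⊕ κ)))) :=
  Op.layer (fun v => .gate hadamardGate (Sum.inl v) none) :: M.wires.map Op.cnotLayer ++
    [Op.layer fun u => .measure (Sum.inr u) (syndrome u),
      Op.parityLayer M.correct syndrome correction,
      Op.layer fun v => .gate notGate (Sum.inl v) (some (correction v))]

theorem length_flatten_prepare_le :
    (M.prepare : List (List (Op (V ⊕ D) (ι ⊕ (D ⊕ V ⊕ V ⊕ κ))))).flatten.length ≤
      3 * Fintype.card V + (M.wires.length + 1) * Fintype.card D := by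
  have hcnot : (M.wires.map fun f =>
      (Op.cnotLayer f : List (Op (V ⊕ D) (ι ⊕ (D ⊕ V ⊕ V ⊕ κ)))).length).sum ≤
      M.wires.length * Fintype.card D := by
    refine (List.sum_le_card_nsmul _ (Fintype.card D) ?_).trans_eq
      (by rw [List.length_map, smul_eq_mul])
    simp only [List.mem_map]
    rintro _ ⟨f, -, rfl⟩
    exact Op.length_cnotLayer_le f
  simp only [prepare, Op.parityLayer, List.length_flatten, List.map_cons, List.map_append,
    List.map_map, List.map_nil, List.sum_cons, List.sum_append, List.sum_nil, Op.length_layer,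
    Function.comp_def]
  linarith

variable [DecidableEq V]

theorem independent_of_mem_prepare {L : List (Op (V ⊕ D) (ι ⊕ (D ⊕ V ⊕ V ⊕ κ)))}
    (hL : L ∈ M.prepare) : L.Pairwise Op.Independent := by
  simp only [prepare, List.cons_append, List.mem_cons, List.mem_append, List.mem_map,
    List.not_mem_nil, or_false] at hL
  obtain rfl | ⟨f, hf, rfl⟩ | rfl | rfl | rfl := hL
  · exact Op.pairwise_layer_gate _ Sum.inl_injective _
  · exact Op.pairwise_cnotLayer (M.wires_injective f hf)
  · exact Op.pairwise_layer_measure Sum.inr_injective syndrome.injective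
  · exact Op.pairwise_parityLayer _ correction.injective fun _ _ => by
      simp [correction, syndrome]
  · exact Op.pairwise_layer_gate _ Sum.inl_injective _

theorem prob_prepare [DecidableEq κ] [DecidableEq ι] (E : Set (ι ⊕ (D ⊕ V ⊕ V ⊕ κ) → ZMod 2))
    (os : List (Op (V ⊕ D) (ι ⊕ (D ⊕ V ⊕ V ⊕ κ)))) (y : ι → ZMod 2) :
    Op.prob E (M.prepare.flatten ++ os) ⟨Sum.elim y 0, Pi.single 0 1⟩ =
      ∑ s, Op.prob E os ⟨Sum.elim y (Sum.elim s (Sum.elim (M.correct *ᵥ s) 0)),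
        tensorKet (fun a => if (M.coord a).2 = 0 then (((√2)⁻¹ ^ Fintype.card V : ℝ) : ℂ) else 0)
          s⟩ := by
  have hsuperposition : hadamardTransform (Pi.single (0 : V → ZMod 2) 1) =
      fun _ => (((√2)⁻¹ ^ Fintype.card V : ℝ) : ℂ) := by
    funext m
    simp only [hadamardTransform, Pi.single_apply, mul_ite, mul_one, mul_zero,
      Finset.sum_ite_eq', mem_univ, if_true, dotProduct_zero, AddChar.map_zero_eq_one,
      Complex.ofReal_one]
  rw [prepare, ← tensorKet_pi_single_zero, List.flatten_append, List.flatten_cons,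
    List.append_assoc, List.append_assoc, prob_hadamardLayer, hsuperposition]
  simp only [List.flatten_cons, List.flatten_nil, List.append_nil, List.append_assoc]
  rw [Op.prob_flatten_cnotLayer, Op.prob_layer_measure_inr _ _ syndrome.injective]
  refine Finset.sum_congr rfl fun s _ => ?_
  rw [Op.prob_parityLayer _ _ _ correction.injective fun _ _ => by simp [correction, syndrome],
    prob_notLayer, ← Sum.elim_zero_zero, ← Sum.elim_zero_zero, extend_syndrome, extend_correction]
  congr 3
  funext a
  change (if s + (M.wires.map wireMap).sum (a + M.correct *ᵥ s) = 0 then _ else _) = _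
  rw [← coord_snd, coord_add_correct_mulVec, add_left_comm, ZModModule.add_self, add_zero]

end Prepare

section Readout

variable [Fintype κ] [DecidableEq κ] [Fintype V] [Fintype R]
  (site : R ↪ V) (θ : R → ℝ) (control : R → ι)

/-- The layers that rotate the qubit `site r` by `θ r` if the input bit `control r` is set, for all
`r`, and then read off the free coordinates in the Fourier basis. -/
noncomputable def readout : List (List (Op (V ⊕ D) (ι ⊕ (D ⊕ V ⊕ V ⊕ κ)))) :=
  [Op.layer fun r => .gate (phaseGate (θ r)) (Sum.inl (site r)) (some (Sum.inl (control r))),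
    Op.layer fun v => .gate hadamardGate (Sum.inl v) none,
    Op.layer fun v => .measure (Sum.inl v) (outcome v),
    Op.parityLayer M.encodeᵀ outcome answer]

theorem length_flatten_readout : (M.readout site θ control).flatten.length =
    Fintype.card R + 2 * Fintype.card V + Fintype.card κ := by
  simp only [readout, Op.parityLayer, List.length_flatten, List.map_cons, List.map_nil,
    List.sum_cons, List.sum_nil, Op.length_layer]
  ring

variable [DecidableEq V] [DecidableEq D]

theorem independent_of_mem_readout {L : List (Op (V ⊕ D) (ι ⊕ (D ⊕ V ⊕ V ⊕ κ)))}
    (hL : L ∈ M.readout site θ control) : L.Pairwise Op.Independent := by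
  simp only [readout, List.mem_cons, List.not_mem_nil, or_false] at hL
  obtain rfl | rfl | rfl | rfl := hL
  · exact Op.pairwise_layer_gate _ (Sum.inl_injective.comp site.injective) _
  · exact Op.pairwise_layer_gate _ Sum.inl_injective _
  · exact Op.pairwise_layer_measure Sum.inl_injective outcome.injective
  · exact Op.pairwise_parityLayer _ answer.injective fun _ _ => by simp [answer, outcome]

theorem prob_readout [Fintype D] [DecidableEq ι] (x : κ → ZMod 2) (y : ι → ZMod 2) (s : D → ZMod 2)
    (r : V → ZMod 2) (φ : (V → ZMod 2) → ℂ) :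
    Op.prob {c | ∀ j, c (answer j) = x j} (M.readout site θ control).flatten
        ⟨Sum.elim y (Sum.elim s (Sum.elim r 0)), tensorKet φ s⟩ =
      ∑ m, if M.encodeᵀ *ᵥ m = x
        then ‖hadamardTransform (fun a => (∏ r,
          if decide (y (control r) = 1) then phase (θ r) (a (site r)) else 1) * φ a) m‖ ^ 2
        else 0 := by
  rw [readout, List.flatten_cons, prob_phaseLayer _ _ _ _ _ site.injective, List.flatten_cons,
    prob_hadamardLayer, List.flatten_cons, Op.prob_layer_measure_inl _ _ outcome.injective]
  refine Finset.sum_congr rfl fun m _ => ?_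
  rw [List.flatten_cons, Op.prob_parityLayer _ _ _ answer.injective fun _ _ => by
    simp [answer, outcome], ← Sum.elim_zero_zero, extend_outcome, extend_answer]
  rw [List.flatten_nil, Op.prob, Branch.weight_tensorKet, Set.indicator_apply]
  refine if_congr funext_iff.symm ?_ rfl
  rw [Fintype.sum_eq_single m fun a ha => by simp [Pi.single_eq_of_ne ha], Pi.single_eq_same]
  rfl

end Readout

section Circuit

variable [Fintype κ] [DecidableEq κ] [Fintype V] [DecidableEq V] [Fintype D] [DecidableEq D]
  [Fintype R] (site : R ↪ V) (θ : R → ℝ) (control : R → ι)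

/-- The circuit that measures, in the Fourier basis, the free coordinates of a uniform superposition
of the strings passing all checks, after the rotations controlled by the input. -/
noncomputable def circuit : ParityCircuit ι κ where
  qubit := V ⊕ D
  work := D ⊕ V ⊕ V ⊕ κ
  layers := M.prepare ++ M.readout site θ control
  independent _ hL := (List.mem_append.1 hL).elim M.independent_of_mem_prepare
    (M.independent_of_mem_readout site θ control)
  output := answer

theorem depth_circuit : (M.circuit site θ control).depth = M.wires.length + 8 := by
  simp [ParityCircuit.depth, circuit, prepare, readout]

theorem size_circuit_le : (M.circuit site θ control).size ≤
    8 * Fintype.card V + (M.wires.length + 3) * Fintype.card D + 2 * Fintype.card κ +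
      Fintype.card R := by
  have hprepare := M.length_flatten_prepare_le (ι := ι)
  change (M.prepare ++ M.readout site θ control).flatten.length + Fintype.card (V ⊕ D) +
    Fintype.card (D ⊕ V ⊕ V ⊕ κ) ≤ _
  simp only [List.flatten_append, List.length_append, length_flatten_readout, Fintype.card_sum]
  linarith

theorem outputProb_circuit [DecidableEq ι] (y : ι → ZMod 2) (x : κ → ZMod 2) :
    (M.circuit site θ control).outputProb y x =
      ‖((2 : ℂ) ^ Fintype.card κ)⁻¹ * ∑ z, (sgn (x ⬝ᵥ z) : ℂ) * ∏ r, if decide (y (control r) = 1)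
        then phase (θ r) ((M.encode *ᵥ z) (site r)) else 1‖ ^ 2 := by
  set W : ℂ := ∑ z, (sgn (x ⬝ᵥ z) : ℂ) * ∏ r, if decide (y (control r) = 1)
    then phase (θ r) ((M.encode *ᵥ z) (site r)) else 1
  calc (M.circuit site θ control).outputProb y x
      = ∑ _s : D → ZMod 2, ∑ m, if M.encodeᵀ *ᵥ m = x
          then ‖(((√2)⁻¹ ^ Fintype.card V : ℝ) : ℂ) * ((√2)⁻¹ ^ Fintype.card V : ℝ) * W‖ ^ 2
          else 0 := by
        change Op.prob {c | ∀ j, c (answer j) = x j}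
          (M.prepare ++ M.readout site θ control).flatten ⟨Sum.elim y 0, Pi.single 0 1⟩ = _
        rw [List.flatten_append, prob_prepare]
        refine Finset.sum_congr rfl fun s _ => ?_
        rw [prob_readout]
        refine Finset.sum_congr rfl fun m _ => if_ctx_congr Iff.rfl (fun hm => ?_) fun _ => rfl
        rw [hadamardTransform_codeword, hm]
    _ = 2 ^ Fintype.card D * (2 ^ Fintype.card D * ‖((2 : ℂ) ^ Fintype.card V)⁻¹ * W‖ ^ 2) := by
        have hsqrt : (((√2)⁻¹ ^ Fintype.card V : ℝ) : ℂ) * ((√2)⁻¹ ^ Fintype.card V : ℝ) =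
            ((2 : ℂ) ^ Fintype.card V)⁻¹ := by
          rw [← Complex.ofReal_mul, ← mul_pow, ← mul_inv, Real.mul_self_sqrt zero_le_two, inv_pow,
            Complex.ofReal_inv, Complex.ofReal_pow, Complex.ofReal_ofNat]
        rw [hsqrt, Finset.sum_const, ← Finset.sum_filter, Finset.sum_const,
          M.card_encode_transpose_mulVec_eq, card_univ, Fintype.card_fun, ZMod.card, nsmul_eq_mul,
          nsmul_eq_mul, Nat.cast_pow, Nat.cast_ofNat]
    _ = ‖((2 : ℂ) ^ Fintype.card κ)⁻¹ * W‖ ^ 2 := by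
        rw [norm_mul, norm_mul, norm_inv, norm_inv, norm_pow, norm_pow, Complex.norm_ofNat,
          M.card_eq, pow_add]
        field_simp

end Circuit

end ParityNetwork

/-! ### Networks computing linear forms -/

namespace LinearForms

variable {N k : ℕ}

/-- The data qubits of the network: `N + 1` copies of a string of length `k`, and the partial sums
of `N` linear forms in it. -/
abbrev Data (N k : ℕ) : Type := (Fin (N + 1) × Fin k) ⊕ (Fin N × Fin (k + 1))

/-- The ancillas of the network, one for each data qubit outside of copy `0`. -/
abbrev Check (N k : ℕ) : Type := (Fin N × Fin k) ⊕ (Fin N × Fin (k + 1))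

/-- The data qubit that an ancilla compares with its prediction. -/
def current : Check N k → Option (Data N k) :=
  some ∘ Sum.map (Prod.map Fin.succ id) id

/-- The data qubit that enters the prediction: the previous copy or the previous partial sum. -/
def previous : Check N k → Option (Data N k)
  | .inl (n, i) => some (.inl (n.castSucc, i))
  | .inr (n, j) => Fin.cases none (fun i => some (.inr (n, i.castSucc))) j

/-- The summand in the next partial sum of the linear form `A n`, taken from the copy `n + 1`. -/
def summand (A : Matrix (Fin N) (Fin k) (ZMod 2)) : Check N k → Option (Data N k)
  | .inl _ => none
  | .inr (n, j) => Fin.cases none (fun i => if A n i = 1 then some (.inl (n.succ, i)) else none) j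

theorem previous_injective {u u' : Check N k} (hu : (previous u).isSome)
    (h : previous u = previous u') : u = u' := by
  rcases u with ⟨n, i⟩ | ⟨n, j⟩ <;> rcases u' with ⟨n', i'⟩ | ⟨n', j'⟩ <;>
    (try cases j using Fin.cases) <;> (try cases j' using Fin.cases) <;> simp_all [previous]

theorem summand_injective {A : Matrix (Fin N) (Fin k) (ZMod 2)} {u u' : Check N k}
    (hu : (summand A u).isSome) (h : summand A u = summand A u') : u = u' := by
  rcases u with ⟨n, i⟩ | ⟨n, j⟩ <;> rcases u' with ⟨n', i'⟩ | ⟨n', j'⟩ <;>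
    (try cases j using Fin.cases) <;> (try cases j' using Fin.cases) <;> simp_all [summand]

theorem wires_injective (A : Matrix (Fin N) (Fin k) (ZMod 2)) :
    ∀ f ∈ [current, previous, summand A], ∀ u u' v, f u = some v → f u' = some v → u = u' := by
  simp only [List.mem_cons, List.not_mem_nil, or_false]
  rintro f (rfl | rfl | rfl) u u' v h h'
  · exact ((Fin.succ_injective N).prodMap Function.injective_id).sumMap Function.injective_id
      (Option.some_injective _ (h.trans h'.symm))
  · exact previous_injective (Option.isSome_of_eq_some h) (h.trans h'.symm)
  · exact summand_injective (Option.isSome_of_eq_some h) (h.trans h'.symm)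

/-- The sum of the checks made by the three layers of wires. -/
def check (A : Matrix (Fin N) (Fin k) (ZMod 2)) :
    (Data N k → ZMod 2) →ₗ[ZMod 2] (Check N k → ZMod 2) :=
  ([current, previous, summand A].map wireMap).sum

section Check

variable (A : Matrix (Fin N) (Fin k) (ZMod 2)) (a : Data N k → ZMod 2)

theorem check_inl (n : Fin N) (i : Fin k) :
    check A a (.inl (n, i)) = a (.inl (n.succ, i)) + a (.inl (n.castSucc, i)) := by
  simp [check, wireMap_apply, current, previous, summand]

theorem check_inr_zero (n : Fin N) : check A a (.inr (n, 0)) = a (.inr (n, 0)) := by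
  simp [check, wireMap_apply, current, previous, summand]

theorem check_inr_succ (n : Fin N) (i : Fin k) : check A a (.inr (n, i.succ)) =
    a (.inr (n, i.succ)) + (a (.inr (n, i.castSucc)) + A n i * a (.inl (n.succ, i))) := by
  rcases zmod_two_eq_zero_or_one (A n i) with h | h <;>
    simp [check, wireMap_apply, current, previous, summand, h]

variable {A a}

theorem apply_inl_of_check_eq_zero (h : check A a = 0) (n : Fin (N + 1)) (i : Fin k) :
    a (.inl (n, i)) = a (.inl (0, i)) := by
  induction n using Fin.induction with
  | zero => rfl
  | succ n ih =>
    rw [← ih, ← sub_eq_zero, ZModModule.sub_eq_add, ← check_inl A, h, Pi.zero_apply]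

theorem apply_inr_of_check_eq_zero (h : check A a = 0) (n : Fin N) (j : Fin (k + 1)) :
    a (.inr (n, j)) = Fin.partialSum (fun i => A n i * a (.inl (0, i))) j := by
  induction j using Fin.induction with
  | zero => rw [Fin.partialSum_zero, ← check_inr_zero A a n, h, Pi.zero_apply]
  | succ i ih =>
    rw [Fin.partialSum_succ, ← ih, ← apply_inl_of_check_eq_zero h n.succ, ← sub_eq_zero,
      ZModModule.sub_eq_add, ← check_inr_succ, h, Pi.zero_apply]

end Check

/-- Copy `0` of the string together with the outcomes of the checks. -/
noncomputable def coord (A : Matrix (Fin N) (Fin k) (ZMod 2)) :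
    (Data N k → ZMod 2) ≃ₗ[ZMod 2] (Fin k → ZMod 2) × (Check N k → ZMod 2) :=
  LinearMap.linearEquivOfInjective
    ((LinearMap.funLeft _ _ fun i => .inl (0, i)).prod (check A))
    (by
      refine (injective_iff_map_eq_zero _).2 fun a ha => ?_
      obtain ⟨hzero, hcheck⟩ := Prod.mk_eq_zero.1 ha
      replace hzero (i : Fin k) : a (.inl (0, i)) = 0 := congrFun hzero i
      have hinl (n : Fin (N + 1)) (i : Fin k) : a (.inl (n, i)) = 0 :=
        (apply_inl_of_check_eq_zero hcheck n i).trans (hzero i)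
      have hinr (n : Fin N) (j : Fin (k + 1)) : a (.inr (n, j)) = 0 := by
        rw [apply_inr_of_check_eq_zero hcheck, Fin.partialSum]
        simp [hzero]
      funext v
      rcases v with ⟨n, i⟩ | ⟨n, j⟩
      · exact hinl n i
      · exact hinr n j)
    (by
      simp only [Module.finrank_prod, Module.finrank_pi, Fintype.card_sum, Fintype.card_prod,
        Fintype.card_fin]
      ring)

/-- The network whose strings passing all checks consist of `N + 1` copies of a string `z` and the
partial sums of the entries of `A *ᵥ z`. Each linear form has a copy of its own, so that no qubit
controls two gates of a layer. -/
noncomputable def network (A : Matrix (Fin N) (Fin k) (ZMod 2)) :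
    ParityNetwork (Fin k) (Data N k) (Check N k) where
  wires := [current, previous, summand A]
  wires_injective := wires_injective A
  coord := coord A
  coord_snd _ := rfl

/-- The qubits holding the values of the linear forms: the last partial sums. -/
def valueQubit : Fin N ↪ Data N k :=
  (Function.Embedding.sectL (Fin N) (Fin.last k)).trans .inr

theorem network_encode_mulVec_valueQubit (A : Matrix (Fin N) (Fin k) (ZMod 2))
    (z : Fin k → ZMod 2) (n : Fin N) :
    ((network A).encode *ᵥ z) (valueQubit n) = (A *ᵥ z) n := by
  have hcoord : coord A ((network A).encode *ᵥ z) = (z, 0) := by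
    rw [ParityNetwork.encode_mulVec]
    exact (coord A).apply_symm_apply _
  have hcheck : check A ((network A).encode *ᵥ z) = 0 := congrArg Prod.snd hcoord
  have hzero (i : Fin k) : ((network A).encode *ᵥ z) (.inl (0, i)) = z i :=
    congrFun (congrArg Prod.fst hcoord) i
  refine (apply_inr_of_check_eq_zero hcheck n (Fin.last k)).trans ?_
  simp only [hzero]
  rw [Fin.partialSum, Fin.val_last, List.take_of_length_le List.length_ofFn.le, List.sum_ofFn]
  rfl

end LinearForms

/-! ### The decoder -/

theorem sum_sgn_mul_sgn {α : Type*} [Fintype α] (u v : α → ZMod 2) :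
    ∑ a, sgn (u a) * sgn (v a) = Fintype.card α - 2 * hammingDist u v := by
  have hterm (a : α) : sgn (u a) * sgn (v a) = 1 - 2 * if u a ≠ v a then 1 else 0 := by
    rcases zmod_two_eq_zero_or_one (u a) with hu | hu <;>
      rcases zmod_two_eq_zero_or_one (v a) with hv | hv <;> rw [hu, hv] <;> norm_num [sgn_one]
  simp only [hterm, Finset.sum_sub_distrib, ← Finset.mul_sum, Finset.sum_boole, Finset.sum_const,
    card_univ, nsmul_eq_mul, mul_one, hammingDist]

section Decoder

variable (k : ℕ)

/-- The label of a pair of strings, as an index of a linear form. -/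
noncomputable def pairIndex : (Fin k → ZMod 2) × (Fin k → ZMod 2) ≃
    Fin (Fintype.card ((Fin k → ZMod 2) × (Fin k → ZMod 2))) :=
  Fintype.equivFin _

/-- The matrix whose row with the label `(S, w)` is `S`. -/
noncomputable def pairForms :
    Matrix (Fin (Fintype.card ((Fin k → ZMod 2) × (Fin k → ZMod 2)))) (Fin k) (ZMod 2) :=
  Matrix.of fun n => ((pairIndex k).symm n).1

/-- The circuit decoding the Hadamard code. For all strings `S` and `w`, it rotates a qubit holding
`S ⬝ᵥ z` by `± π / 2 ^ k` if the input bit `w` is set, the sign being that of `S ⬝ᵥ w`. -/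
noncomputable def decoder : ParityCircuit (Fin k → ZMod 2) (Fin k) :=
  (LinearForms.network (pairForms k)).circuit
    ((pairIndex k).toEmbedding.trans LinearForms.valueQubit)
    (fun r => Real.pi / 2 ^ k * sgn (r.1 ⬝ᵥ r.2)) Prod.snd

theorem depth_decoder : (decoder k).depth = 11 :=
  ParityNetwork.depth_circuit _ _ _ _

theorem size_decoder_le :
    (decoder k).size ≤ 28 * (2 ^ k) ^ 3 + 15 * (2 ^ k) ^ 2 + 10 * 2 ^ k := by
  have hk : k ≤ 2 ^ k := Nat.lt_two_pow_self.le
  refine (ParityNetwork.size_circuit_le _ _ _ _).trans ?_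
  simp only [Fintype.card_sum, Fintype.card_prod, Fintype.card_fin, Fintype.card_fun, ZMod.card]
  change 8 * ((2 ^ k * 2 ^ k + 1) * k + 2 ^ k * 2 ^ k * (k + 1)) +
    (3 + 3) * (2 ^ k * 2 ^ k * k + 2 ^ k * 2 ^ k * (k + 1)) + 2 * k + 2 ^ k * 2 ^ k ≤ _
  nlinarith [Nat.mul_le_mul_left (2 ^ k * 2 ^ k) hk]

variable {k}

theorem prod_phase (y : (Fin k → ZMod 2) → ZMod 2) (z : Fin k → ZMod 2) :
    ∏ r : (Fin k → ZMod 2) × (Fin k → ZMod 2), (if decide (y r.2 = 1)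
      then phase (Real.pi / 2 ^ k * sgn (r.1 ⬝ᵥ r.2)) (r.1 ⬝ᵥ z) else 1) = sgn (y z) := by
  let g (w : Fin k → ZMod 2) : ℝ := if y w = 1 then Real.pi / 2 ^ k else 0
  have hfactor (r : (Fin k → ZMod 2) × (Fin k → ZMod 2)) : (if decide (y r.2 = 1)
      then phase (Real.pi / 2 ^ k * sgn (r.1 ⬝ᵥ r.2)) (r.1 ⬝ᵥ z) else 1) =
        Complex.exp (((g r.2 * (sgn (r.1 ⬝ᵥ r.2) * sgn (r.1 ⬝ᵥ z)) : ℝ) : ℂ) * Complex.I) := by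
    by_cases h : y r.2 = 1
    · simp only [h, decide_true, if_true, phase, g, mul_assoc]
    · simp only [h, decide_false, if_false, g, zero_mul, Complex.ofReal_zero, Complex.exp_zero,
        Bool.false_eq_true]
  simp only [hfactor]
  rw [← Complex.exp_sum, ← Finset.sum_mul, ← Complex.ofReal_sum, Fintype.sum_prod_type,
    sum_mul_sgn_mul_sgn, Fintype.card_fin]
  rcases zmod_two_eq_zero_or_one (y z) with h | h
  · simp [g, h]
  · rw [show g z = Real.pi / 2 ^ k from if_pos h, mul_div_cancel₀ _ (by positivity),
      Complex.exp_pi_mul_I, h, sgn_one, Complex.ofReal_neg, Complex.ofReal_one]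

theorem encode_pairForms_mulVec (z : Fin k → ZMod 2) (r : (Fin k → ZMod 2) × (Fin k → ZMod 2)) :
    ((LinearForms.network (pairForms k)).encode *ᵥ z)
      ((pairIndex k).toEmbedding.trans LinearForms.valueQubit r) = r.1 ⬝ᵥ z := by
  refine (LinearForms.network_encode_mulVec_valueQubit _ z (pairIndex k r)).trans ?_
  change ((pairIndex k).symm (pairIndex k r)).1 ⬝ᵥ z = _
  rw [Equiv.symm_apply_apply]

theorem outputProb_decoder (y : (Fin k → ZMod 2) → ZMod 2) (x : Fin k → ZMod 2) :
    (decoder k).outputProb y x = (1 - 2 * hammingDist y (hadamardCode x) / 2 ^ k) ^ 2 := by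
  have hsum : ∑ z, (sgn (x ⬝ᵥ z) : ℂ) * sgn (y z) =
      ((2 ^ k - 2 * hammingDist y (hadamardCode x) : ℝ) : ℂ) := by
    have h := sum_sgn_mul_sgn (hadamardCode x) y
    rw [hammingDist_comm, Fintype.card_fun, ZMod.card, Fintype.card_fin, Nat.cast_pow,
      Nat.cast_ofNat] at h
    rw [← h, Complex.ofReal_sum]
    exact Finset.sum_congr rfl fun z _ => (Complex.ofReal_mul _ _).symm
  rw [decoder, ParityNetwork.outputProb_circuit]
  simp only [encode_pairForms_mulVec, prod_phase, hsum]
  rw [Fintype.card_fin, norm_mul, mul_pow, Complex.norm_real, Real.norm_eq_abs, sq_abs, norm_inv,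
    norm_pow, Complex.norm_ofNat]
  field_simp

end Decoder

theorem theorem4p1p1 :
    ∃ C : (k : ℕ) → ParityCircuit (Fin k → ZMod 2) (Fin k),
      IsQNC0Parity C ∧ (∀ k, (C k).depth ≤ 65) ∧
      ∃ c : ℝ, 0 < c ∧
        ∀ (k : ℕ) (ε : ℝ), 0 < ε → ε ≤ 1 / 2 →
          ∀ (y : (Fin k → ZMod 2) → ZMod 2) (x : Fin k → ZMod 2),
            (hammingDist y (hadamardCode x) : ℝ) ≤ (1 / 2 - ε) * (2 : ℝ) ^ k →
            c * ε ^ 2 ≤ (C k).outputProb y x := by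
  refine ⟨decoder, ⟨⟨11, fun k => (depth_decoder k).le⟩,
    28 * .X ^ 3 + 15 * .X ^ 2 + 10 * .X, fun k => ?_⟩,
    fun k => (depth_decoder k).le.trans (by norm_num), 4, by norm_num, ?_⟩
  · simpa using size_decoder_le k
  · intro k ε hε _ y x hdist
    have hbias : 2 * ε ≤ 1 - 2 * hammingDist y (hadamardCode x) / 2 ^ k := by
      rw [mul_div_assoc, le_sub_comm]
      have := (div_le_iff₀ (by positivity)).2 hdist
      linarith
    calc 4 * ε ^ 2 = (2 * ε) ^ 2 := by ring
      _ ≤ _ := pow_le_pow_left₀ (by positivity) hbias 2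
      _ = (decoder k).outputProb y x := (outputProb_decoder y x).symm
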